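/- Let $\mathbb H\subset \mathrm{SL}(3,\mathbb Z)$ be the discrete Heisenberg group of upper unitriangular integer matrices, let $x$ (resp. $y$, $z$) be the matrix whose only nonzero off-diagonal entry is a $1$ in position $(1,2)$ (resp. $(2,3)$, $(1,3)$), so that $z=xyx^{-1}y^{-1}$ is central, and let $\binom{n}{k}_q=\prod_{i=0}^{k-1}\frac{1-q^{n-i}}{1-q^{i+1}}\in\mathbb Z[q]$. For $h\in\mathbb Z[\mathbb H]$ or $h\in\mathbb R^{\mathbb H}$ put $h^*_\gamma=h_{\gamma^{-1}}$. Elements of $\mathbb Z[\mathbb H]$ act on $\mathbb R^{\mathbb H}$ from both sides by convolution. A formal inverse of an element $h\in\mathbb Z[\mathbb H]$ that is not invertible in $\ell^1(\mathbb H,\mathbb R)$ is a point $h^\sharp\in\mathbb R^{\mathbb H}\smallsetminus\ell^1(\mathbb H,\mathbb R)$ with $h\cdot h^\sharp=h^\sharp\cdot h=1$; a central multiplier of $h^\sharp$ is a central $g\in\mathbb Z[\mathbb H]$ with $g\cdot h^\sharp=h^\sharp\cdot g\in\ell^1(\mathbb H,\mathbb R)$. Let $f=2-x^{-1}-y^{-1}\in\mathbb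 Z[\mathbb H]$, so that $f^*=2-x-y$. With $\mathbb T=\mathbb R/\mathbb Z$ let $X_f=\{v\in\mathbb T^{\mathbb H}:\sum_\gamma f_\gamma v_{\gamma'\gamma}=0\text{ for all }\gamma'\in\mathbb H\}$, a compact group in the product topology, and let $\alpha_f$ be the action $(\alpha_f^\gamma v)_{\gamma'}=v_{\gamma^{-1}\gamma'}$ of $\mathbb H$ on $X_f$. The action is expansive if some neighbourhood $U$ of $0$ in $X_f$ satisfies $\bigcap_\gamma\alpha_f^\gamma(U)=\{0\}$. A point $v\in X_f$ is homoclinic if $\alpha_f^\gamma v\to0$ as $\gamma\to\infty$, and is a summable homoclinic point if moreover $\sum_\gamma\|v_\gamma\|<\infty$, where $\|t\|$ is the distance of $t\in\mathbb T$ from $0$. **Theorem.** 1. For every $n\ge 0$, $(x+y)^n=\sum_{k=0}^n x^ky^{n-k}\binom{n}{k}_{q=z^{-1}}$ in $\mathbb Z[\mathbb H]$. The series $${f^*}^\sharp=\sum_{n=0}^\infty\frac1{2^{n+1}}(x+y)^n=\sum_{n=0}^\infty\frac1{2^{n+1}}\sum_{k=0}^n x^ky^{n-k}\binom{n}{k}_{q=z^{-1}}$$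 converges coordinatewise to an element of $\ell^\infty(\mathbb H,\mathbb R)$, which is a formal inverse of $f^*=2-x-y$. Consequently $f^\sharp:=({f^*}^\sharp)^*$ is a formal inverse of $f$. 2. $(1-z^{-1})^2$ is a central multiplier of ${f^*}^\sharp$; in particular $(1-z^{-1})^2\cdot{f^*}^\sharp\in\ell^1(\mathbb H,\mathbb R)$. Equivalently, $(1-z)^2$ is a central multiplier of $f^\sharp$. 3. The action $\alpha_f$ is nonexpansive, and the point $x^{((1-z)^2)}\in\mathbb T^{\mathbb H}$ with coordinates $$x^{((1-z)^2)}_\gamma=\bigl((f^\sharp)^*\cdot((1-z)^2)^*\bigr)_\gamma \bmod 1=\bigl((1-z^{-1})^2\cdot{f^*}^\sharp\bigr)_\gamma \bmod 1$$ lies in $X_f$ and is a nonzero summable homoclinic point of $\alpha_f$. -/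

import Mathlib

open scoped ENNReal Topology Polynomial

namespace AlgAction

/-! ## Shifts, convolutions and principal algebraic actions of a group `Γ` -/

section General

variable {Γ : Type*} [Group Γ] {A : Type*} [AddCommGroup A]

/-- The left shift `(λ^γ v)_{γ'} = v_{γ⁻¹ γ'}` on `A^Γ`. -/
def leftShift (γ : Γ) : (Γ → A) →+ (Γ → A) where
  toFun v := fun γ' => v (γ⁻¹ * γ')
  map_zero' := rfl
  map_add' _ _ := rfl

/-- The right shift `(ρ^γ v)_{γ'} = v_{γ' γ}` on `A^Γ`. -/
def rightShift (γ : Γ) : (Γ → A) →+ (Γ → A) where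
  toFun v := fun γ' => v (γ' * γ)
  map_zero' := rfl
  map_add' _ _ := rfl

/-- `ρ^f = ∑_γ f_γ ρ^γ` for `f` in the integer group ring. -/
noncomputable def rho (f : MonoidAlgebra ℤ Γ) : (Γ → A) →+ (Γ → A) :=
  f.coeff.sum fun γ c => c • rightShift γ

theorem rho_apply (f : MonoidAlgebra ℤ Γ) (v : Γ → A) (γ' : Γ) :
    rho f v γ' = f.coeff.sum fun γ c => c • v (γ' * γ) := by
  simp [rho, Finsupp.sum, Finset.sum_apply, rightShift]

theorem rho_leftShift (f : MonoidAlgebra ℤ Γ) (γ : Γ) (v : Γ → A) :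
    rho f (leftShift γ v) = leftShift γ (rho f v) := by
  funext γ'
  rw [rho_apply]
  change _ = rho f v (γ⁻¹ * γ')
  rw [rho_apply]
  simp [leftShift, mul_assoc]

/-- The involution `h ↦ h^*`, `h^*_γ = h_{γ⁻¹}`, on the integer group ring. -/
noncomputable def involution (h : MonoidAlgebra ℤ Γ) : MonoidAlgebra ℤ Γ :=
  MonoidAlgebra.mapDomain (fun γ => γ⁻¹) h

/-- The involution `v ↦ v^*`, `v^*_γ = v_{γ⁻¹}`, on `ℝ^Γ`. -/
def starFun (v : Γ → ℝ) : Γ → ℝ := fun γ => v γ⁻¹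

/-- The product `h · v` of `h ∈ ℤ[Γ]` and `v ∈ ℝ^Γ`: `(h · v)_γ = ∑_δ h_δ v_{δ⁻¹ γ}`. -/
noncomputable def lmul (h : MonoidAlgebra ℤ Γ) (v : Γ → ℝ) : Γ → ℝ :=
  fun γ => h.coeff.sum fun δ c => (c : ℝ) * v (δ⁻¹ * γ)

/-- The product `v · h` of `v ∈ ℝ^Γ` and `h ∈ ℤ[Γ]`: `(v · h)_γ = ∑_δ v_{γ δ⁻¹} h_δ`. -/
noncomputable def rmul (v : Γ → ℝ) (h : MonoidAlgebra ℤ Γ) : Γ → ℝ :=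
  fun γ => h.coeff.sum fun δ c => v (γ * δ⁻¹) * (c : ℝ)

/-- An element of `ℤ[Γ]` viewed as a point of `ℝ^Γ`. -/
def coords (h : MonoidAlgebra ℤ Γ) : Γ → ℝ := fun γ => (h.coeff γ : ℝ)

/-- `h ∈ ℤ[Γ]` is invertible in `ℓ¹(Γ, ℝ)`. -/
def InvertibleL1 (h : MonoidAlgebra ℤ Γ) : Prop :=
  ∃ v : Γ → ℝ, Memℓp v 1 ∧ lmul h v = coords 1 ∧ rmul v h = coords 1

/-- `w` is a formal inverse of `h ∈ ℤ[Γ]`: `h` is not invertible in `ℓ¹(Γ, ℝ)`, and `w` is a point of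
`ℝ^Γ` outside `ℓ¹(Γ, ℝ)` with `w · h = h · w = 1`. -/
structure IsFormalInverse (h : MonoidAlgebra ℤ Γ) (w : Γ → ℝ) : Prop where
  not_invertible : ¬ InvertibleL1 h
  not_mem : ¬ Memℓp w 1
  left : lmul h w = coords 1
  right : rmul w h = coords 1

/-- `g` is a central multiplier of `w`: `g` is central in `ℤ[Γ]` and
`g · w = w · g` is a point of `ℓ¹(Γ, ℝ)`. -/
structure IsCentralMultiplier (g : MonoidAlgebra ℤ Γ) (w : Γ → ℝ) : Prop where
  central : ∀ h : MonoidAlgebra ℤ Γ, g * h = h * g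
  comm : lmul g w = rmul w g
  mem : Memℓp (lmul g w) 1

/-- The point `((w^* · g^*)_γ mod 1)_γ` of `𝕋^Γ`. -/
noncomputable def reducedPoint (w : Γ → ℝ) (g : MonoidAlgebra ℤ Γ) : Γ → UnitAddCircle :=
  fun γ => ((rmul (starFun w) (involution g) γ : ℝ) : UnitAddCircle)

end General

/-- An action of `Γ` by continuous automorphisms of a topological abelian group `X`. -/
structure AlgebraicAction (Γ X : Type*) [Group Γ] [AddCommGroup X] [TopologicalSpace X] where
  act : Γ → (X ≃ₜ+ X)
  act_one : ∀ v, act 1 v = v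
  act_mul : ∀ γ δ v, act (γ * δ) v = act γ (act δ v)

namespace AlgebraicAction

variable {Γ X : Type*} [Group Γ] [AddCommGroup X] [TopologicalSpace X]

/-- `α` is expansive: some neighbourhood `U` of `0` satisfies `⋂_γ α^γ(U) = {0}`. -/
def IsExpansive (α : AlgebraicAction Γ X) : Prop :=
  ∃ U ∈ 𝓝 (0 : X), ⋂ γ : Γ, (α.act γ) '' U = {0}

/-- `x` is homoclinic: `α^γ x → 0` as `γ → ∞` in the discrete group `Γ`. -/
def IsHomoclinic (α : AlgebraicAction Γ X) (x : X) : Prop :=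
  Filter.Tendsto (fun γ : Γ => α.act γ x) Filter.cofinite (𝓝 0)

end AlgebraicAction

section Principal

variable {Γ : Type*} [Group Γ]

/-- `X_f = ker ρ^f ⊆ 𝕋^Γ`, with the topology induced by the product topology. -/
noncomputable def principalGroup (f : MonoidAlgebra ℤ Γ) : AddSubgroup (Γ → UnitAddCircle) :=
  (rho f).ker

/-- The restriction of `λ^γ` to `X_f`. -/
noncomputable def principalAut (f : MonoidAlgebra ℤ Γ) (γ : Γ) :
    principalGroup f ≃ₜ+ principalGroup f where
  toFun v := ⟨leftShift γ v.1, by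
    have hv : rho f v.1 = 0 := v.2
    change rho f (leftShift γ v.1) = 0
    rw [rho_leftShift, hv, map_zero]⟩
  invFun v := ⟨leftShift γ⁻¹ v.1, by
    have hv : rho f v.1 = 0 := v.2
    change rho f (leftShift γ⁻¹ v.1) = 0
    rw [rho_leftShift, hv, map_zero]⟩
  left_inv v := by ext γ'; simp [leftShift]
  right_inv v := by ext γ'; simp [leftShift]
  map_add' v w := by ext γ'; simp [leftShift]
  continuous_toFun := by
    refine Continuous.subtype_mk (continuous_pi fun γ' => ?_) _
    exact (continuous_apply (γ⁻¹ * γ')).comp continuous_subtype_val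
  continuous_invFun := by
    refine Continuous.subtype_mk (continuous_pi fun γ' => ?_) _
    exact (continuous_apply (γ⁻¹⁻¹ * γ')).comp continuous_subtype_val

/-- The principal algebraic action `α_f`, the restriction of the left shift `λ` to `X_f`. -/
noncomputable def principalAction (f : MonoidAlgebra ℤ Γ) :
    AlgebraicAction Γ (principalGroup f) where
  act := principalAut f
  act_one v := by
    apply Subtype.ext; funext γ'
    change v.1 (1⁻¹ * γ') = v.1 γ'
    simp
  act_mul γ δ v := by
    apply Subtype.ext; funext γ'
    change v.1 ((γ * δ)⁻¹ * γ') = v.1 (δ⁻¹ * (γ⁻¹ * γ'))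
    simp [mul_assoc]

/-- `x ∈ X_f` is a summable homoclinic point: it is homoclinic for `α_f` and `∑_γ ‖x_γ‖ < ∞`, where
`‖t‖` is the distance of `t ∈ 𝕋 = ℝ/ℤ` from `0`. -/
def IsSummableHomoclinic (f : MonoidAlgebra ℤ Γ) (x : principalGroup f) : Prop :=
  (principalAction f).IsHomoclinic x ∧ Summable fun γ : Γ => ‖x.1 γ‖

end Principal

/-! ## `q`-binomial coefficients -/

theorem qBinomial_dvd (n k : ℕ) :
    (∏ i ∈ Finset.range k, ((Polynomial.X : ℤ[X]) ^ (i + 1) - 1)) ∣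
      ∏ i ∈ Finset.range k, ((Polynomial.X : ℤ[X]) ^ (n - i) - 1) := by
  induction n generalizing k with
  | zero =>
    cases k with
    | zero => simp
    | succ k => simp [Finset.prod_range_succ]
  | succ n ih =>
    cases k with
    | zero => simp
    | succ k =>
      have h1 : (∏ i ∈ Finset.range (k + 1), ((Polynomial.X : ℤ[X]) ^ (n + 1 - i) - 1)) =
          Polynomial.X ^ (k + 1) *
            (∏ i ∈ Finset.range (k + 1), ((Polynomial.X : ℤ[X]) ^ (n - i) - 1)) +
          (∏ i ∈ Finset.range k, ((Polynomial.X : ℤ[X]) ^ (n - i) - 1)) *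
            (Polynomial.X ^ (k + 1) - 1) := by
        rw [Finset.prod_range_succ', Finset.prod_range_succ]
        simp only [Nat.add_sub_add_right, Nat.sub_zero]
        rcases le_or_gt k n with h | h
        · obtain ⟨m, rfl⟩ := Nat.exists_eq_add_of_le h
          rw [Nat.add_sub_cancel_left]
          ring
        · have h0 : (∏ i ∈ Finset.range k, ((Polynomial.X : ℤ[X]) ^ (n - i) - 1)) = 0 :=
            Finset.prod_eq_zero (Finset.mem_range.2 h) (by simp)
          rw [h0]; ring
      rw [h1]
      refine dvd_add ((ih (k + 1)).mul_left _) ?_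
      rw [Finset.prod_range_succ]
      exact mul_dvd_mul_right (ih k) _

theorem qBinomial_monic (k : ℕ) :
    (∏ i ∈ Finset.range k, ((Polynomial.X : ℤ[X]) ^ (i + 1) - 1)).Monic :=
  Polynomial.monic_prod_of_monic _ _ fun i _ =>
    Polynomial.monic_X_pow_sub_C (1 : ℤ) (Nat.succ_ne_zero i)

/-- The `q`-binomial coefficient `∏_{i<k} (1 - q^{n-i}) / (1 - q^{i+1})`, as a polynomial in `q`. The
quotient is exact, see `qBinomial_mul`; the signs in numerator and denominator are changed
simultaneously so that the denominator is monic. -/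
noncomputable def qBinomial (n k : ℕ) : ℤ[X] :=
  (∏ i ∈ Finset.range k, ((Polynomial.X : ℤ[X]) ^ (n - i) - 1)) /ₘ
    ∏ i ∈ Finset.range k, ((Polynomial.X : ℤ[X]) ^ (i + 1) - 1)

theorem qBinomial_mul (n k : ℕ) :
    qBinomial n k * ∏ i ∈ Finset.range k, (1 - (Polynomial.X : ℤ[X]) ^ (i + 1)) =
      ∏ i ∈ Finset.range k, (1 - (Polynomial.X : ℤ[X]) ^ (n - i)) := by
  have hs : ∀ e : ℕ → ℕ, (∏ i ∈ Finset.range k, (1 - (Polynomial.X : ℤ[X]) ^ (e i))) =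
      (-1) ^ k * ∏ i ∈ Finset.range k, ((Polynomial.X : ℤ[X]) ^ (e i) - 1) := fun e => by
    have : ∀ i ∈ Finset.range k, (1 - (Polynomial.X : ℤ[X]) ^ (e i)) =
        (-1) * ((Polynomial.X : ℤ[X]) ^ (e i) - 1) := fun i _ => by ring
    rw [Finset.prod_congr rfl this, Finset.prod_mul_distrib, Finset.prod_const, Finset.card_range]
  obtain ⟨c, hc⟩ := qBinomial_dvd n k
  have hq : qBinomial n k = c := by
    rw [qBinomial, hc, Polynomial.mul_divByMonic_cancel_left _ (qBinomial_monic k)]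
  rw [hs, hs (fun i => n - i), hc, hq]
  ring

/-! ## The discrete Heisenberg group -/

/-- The upper unitriangular integer matrix with entries `a`, `b`, `c` at `(1,2)`, `(1,3)`, `(2,3)`. -/
def uni (a b c : ℤ) : Matrix.SpecialLinearGroup (Fin 3) ℤ :=
  ⟨!![1, a, b; 0, 1, c; 0, 0, 1], by simp [Matrix.det_fin_three]⟩

theorem uni_mul (a b c a' b' c' : ℤ) :
    uni a b c * uni a' b' c' = uni (a + a') (b + b' + a * c') (c + c') := by
  apply Subtype.ext
  rw [Matrix.SpecialLinearGroup.coe_mul]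
  ext i j
  fin_cases i <;> fin_cases j <;>
    simp [uni, Matrix.mul_apply, Fin.sum_univ_three] <;> ring

theorem uni_zero : uni 0 0 0 = 1 := by
  ext i j
  fin_cases i <;> fin_cases j <;> simp [uni]

/-- The discrete Heisenberg group, as a subgroup of `SL(3, ℤ)`. -/
def Heis : Subgroup (Matrix.SpecialLinearGroup (Fin 3) ℤ) where
  carrier := {M | ∃ a b c : ℤ, M = uni a b c}
  one_mem' := ⟨0, 0, 0, uni_zero.symm⟩
  mul_mem' := by
    rintro _ _ ⟨a, b, c, rfl⟩ ⟨a', b', c', rfl⟩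
    exact ⟨_, _, _, uni_mul a b c a' b' c'⟩
  inv_mem' := by
    rintro _ ⟨a, b, c, rfl⟩
    refine ⟨-a, a * c - b, -c, inv_eq_of_mul_eq_one_right ?_⟩
    rw [uni_mul, ← uni_zero]
    congr 1 <;> ring

/-- The generator `x`. -/
def genX : Heis := ⟨uni 1 0 0, 1, 0, 0, rfl⟩

/-- The generator `y`. -/
def genY : Heis := ⟨uni 0 0 1, 0, 0, 1, rfl⟩

/-- The central element `z = x y x⁻¹ y⁻¹`. -/
def genZ : Heis := ⟨uni 0 1 0, 0, 1, 0, rfl⟩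

theorem genZ_eq : genZ = genX * genY * genX⁻¹ * genY⁻¹ := by
  rw [eq_mul_inv_iff_mul_eq, eq_mul_inv_iff_mul_eq]
  apply Subtype.ext
  simp [genX, genY, genZ, uni_mul]

/-- A group element, viewed in `ℤ[ℍ]`. -/
noncomputable def el (γ : Heis) : MonoidAlgebra ℤ Heis := MonoidAlgebra.of ℤ Heis γ

/-- `f = 2 - x⁻¹ - y⁻¹ ∈ ℤ[ℍ]`. -/
noncomputable def fHeis : MonoidAlgebra ℤ Heis := 2 - el genX⁻¹ - el genY⁻¹

theorem involution_fHeis : involution fHeis = 2 - el genX - el genY := by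
  ext γ
  have h : ∀ h : MonoidAlgebra ℤ Heis, involution h =
      ⟨Finsupp.mapDomain.addMonoidHom (fun γ => γ⁻¹) h.coeff⟩ := fun _ => rfl
  rw [h, fHeis]
  simp [el, MonoidAlgebra.of, Finsupp.mapDomain_single, map_sub]

/-- The formal series `∑_{n ≥ 0} 2^{-(n+1)} (x + y)^n`, evaluated coordinatewise. -/
noncomputable def fStarSharp : Heis → ℝ :=
  fun γ => ∑' n : ℕ, (1 / 2 ^ (n + 1) : ℝ) * (((el genX + el genY) ^ n).coeff γ : ℝ)

/-- The formal inverse `f^♯` of `f`, determined by `(f^♯)^* = (f^*)^♯`. -/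
noncomputable def fSharp : Heis → ℝ := starFun fStarSharp

end AlgAction

open AlgAction

/-!
Put `S = x + y` and `q = z⁻¹`, so that `q` is central and `y x = q x y`. The homomorphism `degree`
with values `1, 1, 0` at `x, y, z` shows that `Sⁿ` is supported in degree `n`; hence every
coordinate of `∑ 2 ^ (-n - 1) Sⁿ` has at most one nonzero term, multiplication by group ring
elements may be carried out term by term (`hasSum_lmul_fStarSharp`), and
`(2 - S) ∑ 2 ^ (-n - 1) Sⁿ` telescopes to `1`. The coefficients of `2 - S` add up to `0`, so it is
not invertible in `ℓ¹`; a formal inverse in `ℓ¹` would contradict this.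

The heart of the matter is the summability of `‖(1 - q) ^ 2 Sⁿ‖₁ / 2 ^ n`. Let
`D n a = ‖(1 - q ^ a) Sⁿ‖₁ / 2 ^ n` (`shiftNorm`). For every word `w` of length `a - 1` one has
`y w x = q ^ a x w y`. So among the words of length `a + 1`, those whose first and last letters
differ can be paired to give a factor `1 + q ^ a`, and `(1 - q ^ a) (1 + q ^ a) = 1 - q ^ (2 a)`.
This gives `D (n + a + 1) a ≤ D n a / 2 + D n (2 a) / 4` (`shiftNorm_add_le`), and the recursion
forces `D n a ≤ 64 (a / n) ^ (3 / 4)` (`le_of_halving_recursion`). Giving each of the two factors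
`1 - q` one half of the word, `‖(1 - q) ^ 2 Sⁿ‖₁ / 2 ^ n = O(n ^ (-3 / 2))`, which is summable.

Everything about `f` and `f^♯` follows by applying the involution. Constant points of `𝕋^ℍ` lie in
`X_f`, are fixed by the action and can be arbitrarily small, so `α_f` is not expansive.
Multiplying `(1 - q) ^ 2 · (f^*)^♯` by `f^*` gives an integer point, so its reduction mod `1` lies
in `X_f`; it is summable, hence homoclinic, and it is nonzero because its coordinate at the
identity is `1 / 2`.
-/

namespace AlgAction

/-! ### The norm of `ℓ¹` on the integer group ring -/

section GroupRing

variable {Γ : Type*}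

/-- The `ℓ¹`-norm `∑_γ |h_γ|` of an element of the integer group ring. -/
noncomputable def l1Norm (h : MonoidAlgebra ℤ Γ) : ℝ := h.coeff.sum fun _ c => |(c : ℝ)|

theorem l1Norm_eq_sum (h : MonoidAlgebra ℤ Γ) {s : Finset Γ} (hs : h.coeff.support ⊆ s) :
    l1Norm h = ∑ γ ∈ s, |(h.coeff γ : ℝ)| :=
  Finsupp.sum_of_support_subset _ hs _ (by simp)

theorem l1Norm_nonneg (h : MonoidAlgebra ℤ Γ) : 0 ≤ l1Norm h :=
  Finset.sum_nonneg fun _ _ => abs_nonneg _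

theorem sum_abs_coeff_le_l1Norm (h : MonoidAlgebra ℤ Γ) (s : Finset Γ) :
    ∑ γ ∈ s, |(h.coeff γ : ℝ)| ≤ l1Norm h := by
  classical
  rw [l1Norm_eq_sum h (Finset.subset_union_right (s₁ := s))]
  exact Finset.sum_le_sum_of_subset_of_nonneg Finset.subset_union_left
    fun _ _ _ => abs_nonneg _

theorem abs_coeff_le_l1Norm (h : MonoidAlgebra ℤ Γ) (γ : Γ) :
    |(h.coeff γ : ℝ)| ≤ l1Norm h := by
  simpa using sum_abs_coeff_le_l1Norm h {γ}

@[simp]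
theorem l1Norm_single (γ : Γ) (c : ℤ) : l1Norm (MonoidAlgebra.single γ c) = |(c : ℝ)| := by
  simp [l1Norm]

@[simp]
theorem l1Norm_zero : l1Norm (0 : MonoidAlgebra ℤ Γ) = 0 := by
  simp [l1Norm]

theorem l1Norm_add_le (h k : MonoidAlgebra ℤ Γ) : l1Norm (h + k) ≤ l1Norm h + l1Norm k := by
  classical
  have hs := Finset.subset_union_left (s₁ := h.coeff.support) (s₂ := k.coeff.support)
  have ks := Finset.subset_union_right (s₁ := h.coeff.support) (s₂ := k.coeff.support)
  rw [l1Norm_eq_sum h hs, l1Norm_eq_sum k ks, l1Norm_eq_sum (h + k) Finsupp.support_add,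
    ← Finset.sum_add_distrib]
  refine Finset.sum_le_sum fun γ _ => ?_
  simpa using abs_add_le (h.coeff γ : ℝ) (k.coeff γ)

theorem l1Norm_neg (h : MonoidAlgebra ℤ Γ) : l1Norm (-h) = l1Norm h := by
  rw [l1Norm_eq_sum (-h) (s := h.coeff.support) (by simp), l1Norm_eq_sum h subset_rfl]
  simp

theorem l1Norm_sub_le (h k : MonoidAlgebra ℤ Γ) : l1Norm (h - k) ≤ l1Norm h + l1Norm k := by
  rw [sub_eq_add_neg, ← l1Norm_neg k]
  exact l1Norm_add_le _ _

theorem l1Norm_single_add {γ : Γ} {c : ℤ} {h : MonoidAlgebra ℤ Γ} (hγ : γ ∉ h.coeff.support)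
    (hc : c ≠ 0) : l1Norm (MonoidAlgebra.single γ c + h) = |(c : ℝ)| + l1Norm h := by
  rw [l1Norm, MonoidAlgebra.coeff_add, Finsupp.sum_add_index_of_disjoint]
  · simp [l1Norm]
  · rw [MonoidAlgebra.coeff_single, Finsupp.support_single (hb := hc)]
    simpa using hγ

theorem memℓp_one_iff_summable {v : Γ → ℝ} : Memℓp v 1 ↔ Summable fun γ => |v γ| := by
  rw [memℓp_gen_iff (by simp)]
  simp

variable [Group Γ]

theorem l1Norm_one : l1Norm (1 : MonoidAlgebra ℤ Γ) = 1 := by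
  simp [MonoidAlgebra.one_def]

theorem l1Norm_single_mul (γ : Γ) (c : ℤ) (h : MonoidAlgebra ℤ Γ) :
    l1Norm (MonoidAlgebra.single γ c * h) ≤ |(c : ℝ)| * l1Norm h := by
  induction h using MonoidAlgebra.induction with
  | zero => simp
  | single_add δ d h hδ hd ih =>
    rw [mul_add, MonoidAlgebra.single_mul_single, l1Norm_single_add hδ hd, mul_add]
    refine (l1Norm_add_le _ _).trans ?_
    rw [l1Norm_single]
    push_cast
    rw [abs_mul]
    gcongr

theorem l1Norm_mul_le (g h : MonoidAlgebra ℤ Γ) : l1Norm (g * h) ≤ l1Norm g * l1Norm h := by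
  induction g using MonoidAlgebra.induction with
  | zero => simp
  | single_add δ d g hδ hd ih =>
    rw [add_mul, l1Norm_single_add hδ hd, add_mul]
    exact (l1Norm_add_le _ _).trans (add_le_add (l1Norm_single_mul _ _ _) ih)

theorem l1Norm_pow_le (g : MonoidAlgebra ℤ Γ) {C : ℝ} (hg : l1Norm g ≤ C) (n : ℕ) :
    l1Norm (g ^ n) ≤ C ^ n := by
  induction n with
  | zero => simp [l1Norm_one]
  | succ n ih =>
    rw [pow_succ, pow_succ]
    have hC := (l1Norm_nonneg g).trans hg
    exact (l1Norm_mul_le _ _).trans (mul_le_mul ih hg (l1Norm_nonneg _) (by positivity))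

/-! ### Convolution with integer group ring elements, and the involution -/

theorem lmul_coords (g h : MonoidAlgebra ℤ Γ) : lmul g (coords h) = coords (g * h) := by
  funext γ
  simp only [lmul, coords, MonoidAlgebra.coeff_mul_apply_left, Finsupp.sum]
  push_cast
  rfl

theorem lmul_apply_eq_sum (h : MonoidAlgebra ℤ Γ) (v : Γ → ℝ) (γ : Γ) :
    lmul h v γ = ∑ δ ∈ h.coeff.support, (h.coeff δ : ℝ) * v (δ⁻¹ * γ) := rfl

theorem rmul_apply_eq_sum (v : Γ → ℝ) (h : MonoidAlgebra ℤ Γ) (γ : Γ) :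
    rmul v h γ = ∑ δ ∈ h.coeff.support, v (γ * δ⁻¹) * (h.coeff δ : ℝ) := rfl

theorem rmul_lmul (g h : MonoidAlgebra ℤ Γ) (v : Γ → ℝ) :
    rmul (lmul g v) h = lmul g (rmul v h) := by
  funext γ
  simp only [lmul_apply_eq_sum, rmul_apply_eq_sum, Finset.sum_mul, Finset.mul_sum]
  rw [Finset.sum_comm]
  simp only [mul_assoc]

theorem coeff_involution (h : MonoidAlgebra ℤ Γ) (γ : Γ) :
    (involution h).coeff γ = h.coeff γ⁻¹ := by
  have := Finsupp.mapDomain_apply (inv_injective (G := Γ)) h.coeff γ⁻¹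
  rwa [inv_inv] at this

theorem involution_involution (h : MonoidAlgebra ℤ Γ) : involution (involution h) = h := by
  ext γ
  simp [coeff_involution]

theorem involution_single (γ : Γ) (c : ℤ) :
    involution (MonoidAlgebra.single γ c) = MonoidAlgebra.single γ⁻¹ c :=
  MonoidAlgebra.mapDomain_single

theorem involution_add (g h : MonoidAlgebra ℤ Γ) :
    involution (g + h) = involution g + involution h :=
  MonoidAlgebra.mapDomain_add _ _ _

theorem starFun_starFun (v : Γ → ℝ) : starFun (starFun v) = v := by
  funext γ
  simp [starFun]

theorem starFun_coords_one : starFun (coords (1 : MonoidAlgebra ℤ Γ)) = coords 1 := by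
  classical
  funext γ
  simp [starFun, coords, MonoidAlgebra.one_def, Finsupp.single_apply, eq_comm]

theorem sum_coeff_involution {M : Type*} [AddCommMonoid M] (h : MonoidAlgebra ℤ Γ)
    (F : Γ → ℤ → M) :
    (involution h).coeff.sum F = h.coeff.sum fun γ c => F γ⁻¹ c := by
  change (Finsupp.mapDomain (fun γ : Γ => γ⁻¹) h.coeff).sum F = _
  exact Finsupp.sum_mapDomain_index_inj inv_injective

theorem lmul_involution_starFun (h : MonoidAlgebra ℤ Γ) (v : Γ → ℝ) :
    lmul (involution h) (starFun v) = starFun (rmul v h) := by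
  funext γ
  simp only [lmul, starFun, rmul]
  rw [sum_coeff_involution]
  simp [mul_comm]

theorem rmul_starFun_involution (h : MonoidAlgebra ℤ Γ) (v : Γ → ℝ) :
    rmul (starFun v) (involution h) = starFun (lmul h v) := by
  funext γ
  simp only [lmul, starFun, rmul]
  rw [sum_coeff_involution]
  simp [mul_comm]

theorem memℓp_one_starFun {v : Γ → ℝ} (hv : Memℓp v 1) : Memℓp (starFun v) 1 := by
  rw [memℓp_one_iff_summable] at hv ⊢
  exact hv.comp_injective inv_injective

theorem InvertibleL1.involution {h : MonoidAlgebra ℤ Γ} (hh : InvertibleL1 h) :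
    InvertibleL1 (involution h) := by
  obtain ⟨v, hv, hl, hr⟩ := hh
  exact ⟨starFun v, memℓp_one_starFun hv,
    by rw [lmul_involution_starFun, hr, starFun_coords_one],
    by rw [rmul_starFun_involution, hl, starFun_coords_one]⟩

theorem IsFormalInverse.involution {h : MonoidAlgebra ℤ Γ} {w : Γ → ℝ}
    (hw : IsFormalInverse h w) : IsFormalInverse (involution h) (starFun w) where
  not_invertible hi := hw.not_invertible (by simpa [involution_involution] using hi.involution)
  not_mem hm := hw.not_mem (by simpa [starFun_starFun] using memℓp_one_starFun hm)
  left := by rw [lmul_involution_starFun, hw.right, starFun_coords_one]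
  right := by rw [rmul_starFun_involution, hw.left, starFun_coords_one]

theorem involution_mul (g h : MonoidAlgebra ℤ Γ) :
    involution (g * h) = involution h * involution g := by
  ext γ
  rw [coeff_involution, MonoidAlgebra.coeff_mul_apply_left, MonoidAlgebra.coeff_mul_apply_right,
    sum_coeff_involution]
  simp [coeff_involution, mul_comm]

theorem IsCentralMultiplier.involution {g : MonoidAlgebra ℤ Γ} {w : Γ → ℝ}
    (hg : IsCentralMultiplier g w) : IsCentralMultiplier (involution g) (starFun w) where
  central h := by
    have := congrArg AlgAction.involution (hg.central (AlgAction.involution h))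
    rwa [involution_mul, involution_mul, involution_involution, eq_comm] at this
  comm := by rw [lmul_involution_starFun, rmul_starFun_involution, hg.comm]
  mem := by
    rw [lmul_involution_starFun, ← hg.comm]
    exact memℓp_one_starFun hg.mem

/-- Summing coordinates is multiplicative: `∑_γ (h · v)_γ = (∑_γ h_γ) (∑_γ v_γ)`. -/
theorem hasSum_lmul (h : MonoidAlgebra ℤ Γ) {v : Γ → ℝ} {s : ℝ} (hv : HasSum v s) :
    HasSum (lmul h v) (h.coeff.sum fun _ c => (c : ℝ) * s) := by
  have : lmul h v = fun γ => ∑ δ ∈ h.coeff.support, (h.coeff δ : ℝ) * v (δ⁻¹ * γ) := rfl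
  rw [this]
  refine hasSum_sum fun δ _ => HasSum.mul_left _ ?_
  exact (Equiv.mulLeft δ⁻¹).hasSum_iff.2 hv

/-- An element whose coefficients add up to `0` is not invertible in `ℓ¹`: summing coordinates in
`h · v = 1` would give `0 = 1`. -/
theorem not_invertibleL1_of_sum_eq_zero {h : MonoidAlgebra ℤ Γ}
    (hh : (h.coeff.sum fun _ c => c) = 0) : ¬ InvertibleL1 h := by
  classical
  rintro ⟨v, hv, hl, -⟩
  have hv' : Summable v := (memℓp_one_iff_summable.1 hv).of_abs
  have h1 := hasSum_lmul h hv'.hasSum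
  have h2 : HasSum (coords (1 : MonoidAlgebra ℤ Γ)) 1 := by
    have := hasSum_single (f := coords (1 : MonoidAlgebra ℤ Γ)) 1 fun γ hγ => by
      simp [coords, MonoidAlgebra.one_def, hγ.symm]
    simpa [coords] using this
  rw [hl] at h1
  have h3 := h1.unique h2
  have h4 : (h.coeff.sum fun _ c => (c : ℝ)) = 0 := by
    have := congrArg (Int.cast : ℤ → ℝ) hh
    simpa [Finsupp.sum] using this
  rw [Finsupp.sum, ← Finset.sum_mul] at h3
  rw [Finsupp.sum] at h4
  rw [h4] at h3
  simp at h3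

end GroupRing

/-! ### Words in two `q`-commuting letters -/

section Ring

variable {R : Type*} [Ring R]

/-- Moving a letter `y` to the right and `x` to the left past a word of length `m` costs
`q ^ (m + 1)`, whatever the word is. -/
theorem mul_add_pow_mul_of_qCommute {x y q : R} (hq : ∀ r, q * r = r * q) (h : y * x = q * (x * y))
    (m : ℕ) : y * (x + y) ^ m * x = q ^ (m + 1) * (x * (x + y) ^ m * y) := by
  induction m with
  | zero => simp [h]
  | succ m ih =>
    have hqc : ∀ (k : ℕ) (r : R), q ^ k * r = r * q ^ k := fun k r =>
      ((show Commute q r from hq r).pow_left k).eq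
    calc y * (x + y) ^ (m + 1) * x
        = (y * (x + y) ^ m * x) * x + y * (x + y) ^ m * (y * x) := by
          rw [pow_succ]; noncomm_ring
      _ = q ^ (m + 1) * (x * (x + y) ^ m * (y * x)) + y * (x + y) ^ m * (y * x) := by
          rw [ih]; noncomm_ring
      _ = q ^ (m + 1) * (x * (x + y) ^ m * (q * (x * y))) + y * (x + y) ^ m * (q * (x * y)) := by
          rw [h]
      _ = q ^ (m + 1) * q * (x * (x + y) ^ m * (x * y)) + q * (y * (x + y) ^ m * x) * y := by
          have e1 : x * (x + y) ^ m * (q * (x * y)) = q * (x * (x + y) ^ m * (x * y)) := by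
            rw [← mul_assoc, ← hq]; simp only [mul_assoc]
          have e2 : y * (x + y) ^ m * (q * (x * y)) = q * (y * (x + y) ^ m * x) * y := by
            rw [← mul_assoc, ← hq]; simp only [mul_assoc]
          rw [e1, e2, ← mul_assoc (q ^ (m + 1)) q]
      _ = q ^ (m + 1 + 1) * (x * (x + y) ^ (m + 1) * y) := by
          rw [ih, pow_succ q (m + 1), pow_succ (x + y) m, ← mul_assoc q, ← hqc (m + 1) q]
          noncomm_ring

/-- Words of length `m + 2`, sorted by their first and last letters. Words `x w y` and `y w x` with
the same middle `w` differ by `q ^ (m + 1)`. -/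
theorem one_sub_mul_add_pow_of_qCommute {x y q : R} (hq : ∀ r, q * r = r * q)
    (h : y * x = q * (x * y)) (m n : ℕ) :
    (1 - q ^ (m + 1)) * (x + y) ^ (n + (m + 2)) =
      x * (x + y) ^ m * x * ((1 - q ^ (m + 1)) * (x + y) ^ n) +
      y * (x + y) ^ m * y * ((1 - q ^ (m + 1)) * (x + y) ^ n) +
      x * (x + y) ^ m * y * ((1 - q ^ (2 * (m + 1))) * (x + y) ^ n) := by
  have hqc : ∀ (k : ℕ) (r : R), q ^ k * r = r * q ^ k := fun k r =>
    ((show Commute q r from hq r).pow_left k).eq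
  have e : (x + y) ^ (m + 2) = x * (x + y) ^ m * x + y * (x + y) ^ m * y +
      (1 + q ^ (m + 1)) * (x * (x + y) ^ m * y) := by
    have h1 := mul_add_pow_mul_of_qCommute hq h m
    calc (x + y) ^ (m + 2) = (x + y) * (x + y) ^ m * (x + y) := by
          rw [pow_succ, pow_succ']
      _ = x * (x + y) ^ m * x + y * (x + y) ^ m * y + x * (x + y) ^ m * y
          + y * (x + y) ^ m * x := by noncomm_ring
      _ = _ := by rw [h1]; noncomm_ring
  have comm : ∀ (k : ℕ) (r s : R), (1 - q ^ k) * (r * s) = r * ((1 - q ^ k) * s) := fun k r s => by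
    rw [sub_mul, sub_mul, one_mul, one_mul, mul_sub, ← mul_assoc, hqc, mul_assoc]
  have e2 : (1 - q ^ (m + 1)) * (1 + q ^ (m + 1)) = 1 - q ^ (2 * (m + 1)) := by
    rw [two_mul, pow_add q (m + 1) (m + 1), mul_add, sub_mul, sub_mul]; simp
  rw [add_comm n, pow_add _ (m + 2) n, e, add_mul, add_mul, mul_add, mul_add, comm, comm,
    mul_assoc (1 + q ^ (m + 1)), ← mul_assoc (1 - q ^ (m + 1)) (1 + q ^ (m + 1)), e2, comm]

end Ring

/-! ### A recursive decay estimate -/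

/-- A function `D n a ≤ 2` with `D (n + a + 1) a ≤ D n a / 2 + D n (2 a) / 4` decays at least like
`(a / n) ^ (3 / 4)`. The exponent works because `1 / 2 + 2 ^ (3 / 4) / 4 < 1`. -/
theorem le_of_halving_recursion {D : ℕ → ℕ → ℝ} (h2 : ∀ n a, D n a ≤ 2)
    (hrec : ∀ n a, 1 ≤ a → D (n + (a + 1)) a ≤ D n a / 2 + D n (2 * a) / 4) (n a : ℕ) (ha : 1 ≤ a)
    (hn : 1 ≤ n) : D n a ≤ 64 * ((a : ℝ) / n) ^ (3 / 4 : ℝ) := by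
  induction n using Nat.strong_induction_on generalizing a with
  | _ n ih =>
    have hn0 : (0 : ℝ) < n := by exact_mod_cast hn
    have ha1 : (1 : ℝ) ≤ a := by exact_mod_cast ha
    rcases lt_or_ge n (32 * a) with hlt | hge
    · have h32 : (1 / 32 : ℝ) ≤ (a : ℝ) / n := by
        rw [div_le_div_iff₀ (by norm_num) hn0]
        have : (n : ℝ) ≤ 32 * a := by exact_mod_cast hlt.le
        linarith
      have h1 : (1 / 32 : ℝ) ≤ ((a : ℝ) / n) ^ (3 / 4 : ℝ) :=
        calc (1 / 32 : ℝ) = (1 / 32 : ℝ) ^ (1 : ℝ) := (Real.rpow_one _).symm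
          _ ≤ (1 / 32 : ℝ) ^ (3 / 4 : ℝ) :=
            Real.rpow_le_rpow_of_exponent_ge (by norm_num) (by norm_num) (by norm_num)
          _ ≤ _ := Real.rpow_le_rpow (by norm_num) h32 (by norm_num)
      have := h2 n a
      linarith
    · obtain ⟨k, rfl⟩ : ∃ k, n = k + (a + 1) := ⟨n - (a + 1), by omega⟩
      have hk1 : 1 ≤ k := by omega
      have hk0 : (0 : ℝ) < k := by exact_mod_cast hk1
      have e1 := ih k (by omega) a ha hk1
      have e2 := ih k (by omega) (2 * a) (by omega) hk1
      have e3 := hrec k a ha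
      set N : ℝ := ((k + (a + 1) : ℕ) : ℝ) with hN
      -- the ratio `k / N` is close to `1`
      have hr : (15 / 16 : ℝ) ≤ k / N := by
        rw [div_le_div_iff₀ (by norm_num) hn0]
        have : (32 * a : ℝ) ≤ N := by rw [hN]; exact_mod_cast hge
        have : N = k + (a + 1) := by rw [hN]; push_cast; ring
        linarith
      have hr1 : (15 / 16 : ℝ) ≤ ((k : ℝ) / N) ^ (3 / 4 : ℝ) := by
        have hle : (k : ℝ) / N ≤ 1 := by
          rw [div_le_one hn0, hN]; exact_mod_cast Nat.le_add_right _ _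
        calc (15 / 16 : ℝ) ≤ ((k : ℝ) / N) ^ (1 : ℝ) := by rwa [Real.rpow_one]
          _ ≤ _ := Real.rpow_le_rpow_of_exponent_ge (by linarith) hle (by norm_num)
      have hpow2 : (2 : ℝ) ^ (3 / 4 : ℝ) ≤ 7 / 4 := by
        have h4 : ((2 : ℝ) ^ (3 / 4 : ℝ)) ^ 4 ≤ (7 / 4) ^ 4 := by
          rw [← Real.rpow_natCast, ← Real.rpow_mul (by norm_num)]
          norm_num
        exact le_of_pow_le_pow_left₀ (by norm_num) (by norm_num) h4
      have hsplit : ((a : ℝ) / N) ^ (3 / 4 : ℝ) =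
          ((a : ℝ) / k) ^ (3 / 4 : ℝ) * ((k : ℝ) / N) ^ (3 / 4 : ℝ) := by
        rw [← Real.mul_rpow (by positivity) (by positivity)]
        congr 1
        field_simp
      have hdouble : (((2 * a : ℕ) : ℝ) / k) ^ (3 / 4 : ℝ) =
          (2 : ℝ) ^ (3 / 4 : ℝ) * ((a : ℝ) / k) ^ (3 / 4 : ℝ) := by
        rw [← Real.mul_rpow (by positivity) (by positivity)]
        congr 1
        push_cast
        ring
      rw [hdouble] at e2
      rw [hsplit]
      have hA : 0 ≤ ((a : ℝ) / k) ^ (3 / 4 : ℝ) := by positivity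
      nlinarith [mul_le_mul_of_nonneg_right hpow2 hA, mul_le_mul_of_nonneg_left hr1 hA]

/-! ### The `q`-binomial theorem -/

theorem qBinomial_zero_right (n : ℕ) : qBinomial n 0 = 1 := by
  simpa using qBinomial_mul n 0

theorem prod_one_sub_X_pow_ne_zero (k : ℕ) :
    (∏ i ∈ Finset.range k, (1 - (Polynomial.X : ℤ[X]) ^ (i + 1))) ≠ 0 := by
  refine Finset.prod_ne_zero_iff.2 fun i _ h => ?_
  have := congrArg (Polynomial.eval 0) h
  simp at this

theorem prod_one_sub_X_pow_eq_zero {n k : ℕ} (h : n < k) :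
    (∏ i ∈ Finset.range k, (1 - (Polynomial.X : ℤ[X]) ^ (n - i))) = 0 :=
  Finset.prod_eq_zero (Finset.mem_range.2 h) (by simp)

theorem qBinomial_eq_zero_of_lt {n k : ℕ} (h : n < k) : qBinomial n k = 0 := by
  have := qBinomial_mul n k
  rw [prod_one_sub_X_pow_eq_zero h] at this
  exact (mul_eq_zero.1 this).resolve_right (prod_one_sub_X_pow_ne_zero k)

/-- The `q`-Pascal rule, from which the `q`-binomial theorem follows by induction. -/
theorem qBinomial_succ_succ (n k : ℕ) :
    qBinomial (n + 1) (k + 1) =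
      qBinomial n k + Polynomial.X ^ (k + 1) * qBinomial n (k + 1) := by
  refine mul_right_cancel₀ (prod_one_sub_X_pow_ne_zero (k + 1)) ?_
  rw [add_mul, mul_assoc, qBinomial_mul, qBinomial_mul,
    Finset.prod_range_succ (fun i => 1 - (Polynomial.X : ℤ[X]) ^ (i + 1)), ← mul_assoc,
    qBinomial_mul, Finset.prod_range_succ', Finset.prod_range_succ]
  simp only [Nat.add_sub_add_right, Nat.sub_zero]
  rcases le_or_gt k n with h | h
  · obtain ⟨m, rfl⟩ := Nat.exists_eq_add_of_le h
    rw [Nat.add_sub_cancel_left]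
    ring
  · rw [prod_one_sub_X_pow_eq_zero h]
    ring

section Ring

variable {R : Type*} [Ring R] [Algebra ℤ R]

/-- The `q`-binomial theorem: if `y x = q x y` with `q` central, then
`(x + y) ^ n = ∑ k, x ^ k y ^ (n - k) \binom{n}{k}_q`. -/
theorem add_pow_of_qCommute {x y q : R} (hq : ∀ r, q * r = r * q) (h : y * x = q * (x * y))
    (n : ℕ) : (x + y) ^ n = ∑ k ∈ Finset.range (n + 1),
      x ^ k * y ^ (n - k) * Polynomial.aeval q (qBinomial n k) := by
  have hyx : ∀ k : ℕ, y * x ^ k = x ^ k * y * q ^ k := by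
    intro k
    induction k with
    | zero => simp
    | succ k ih =>
      calc y * x ^ (k + 1) = (y * x ^ k) * x := by rw [pow_succ]; noncomm_ring
        _ = x ^ k * y * (q ^ k * x) := by rw [ih]; noncomm_ring
        _ = x ^ k * (y * x) * q ^ k := by
          rw [((show Commute q x from hq x).pow_left k).eq]; noncomm_ring
        _ = x ^ k * (q * (x * y)) * q ^ k := by rw [h]
        _ = x ^ (k + 1) * y * q ^ (k + 1) := by
          rw [hq, pow_succ x, pow_succ' q]; simp only [mul_assoc]
  induction n with
  | zero => simp [qBinomial_zero_right]
  | succ n ih =>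
    have e1 : y * ∑ k ∈ Finset.range (n + 1),
        x ^ k * y ^ (n - k) * Polynomial.aeval q (qBinomial n k) =
        ∑ k ∈ Finset.range (n + 2), x ^ k * y ^ (n + 1 - k) *
          Polynomial.aeval q (Polynomial.X ^ k * qBinomial n k) := by
      rw [Finset.sum_range_succ _ (n + 1), qBinomial_eq_zero_of_lt (Nat.lt_succ_self n), mul_zero,
        map_zero, mul_zero, add_zero, Finset.mul_sum]
      refine Finset.sum_congr rfl fun k hk => ?_
      have hk' : n + 1 - k = (n - k) + 1 := by
        have := Finset.mem_range.1 hk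
        omega
      rw [map_mul, map_pow, Polynomial.aeval_X, hk', pow_succ' y, ← mul_assoc, ← mul_assoc, hyx]
      have hc := ((show Commute q (y ^ (n - k)) from hq _).pow_left k).eq
      rw [mul_assoc (x ^ k * y) (q ^ k), hc]
      simp only [mul_assoc]
    rw [pow_succ', ih, add_mul, e1, Finset.mul_sum, Finset.sum_range_succ' _ (n + 1),
      Finset.sum_range_succ' _ (n + 1), ← add_assoc, ← Finset.sum_add_distrib]
    congr 1
    · refine Finset.sum_congr rfl fun k _ => ?_
      rw [qBinomial_succ_succ, map_add, mul_add, Nat.add_sub_add_right, pow_succ' x]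
      simp only [mul_assoc]
    · simp [qBinomial_zero_right]

end Ring

/-! ### Degree and the series `∑ 2 ^ (-n - 1) (x + y) ^ n` -/

/-- The sum of the entries at `(1,2)` and `(2,3)`, a homomorphism to `ℤ` that takes the value `1` at
`x` and `y` and `0` at `z`. -/
def degree (γ : Heis) : ℤ := γ.1.1 0 1 + γ.1.1 1 2

theorem degree_mul (γ δ : Heis) : degree (γ * δ) = degree γ + degree δ := by
  obtain ⟨_, a, b, c, rfl⟩ := γ
  obtain ⟨_, a', b', c', rfl⟩ := δ
  change (uni a b c * uni a' b' c').1 0 1 + (uni a b c * uni a' b' c').1 1 2 = _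
  rw [uni_mul]
  simp [degree, uni]
  ring

@[simp] theorem degree_genX : degree genX = 1 := by simp [degree, genX, uni]

@[simp] theorem degree_genY : degree genY = 1 := by simp [degree, genY, uni]

@[simp] theorem degree_one : degree 1 = 0 := by simp [degree]

theorem el_mul (γ δ : Heis) : el γ * el δ = el (γ * δ) := by simp [el]

theorem el_pow (γ : Heis) (n : ℕ) : el γ ^ n = el (γ ^ n) := by simp [el]

theorem genZ_mul_comm (γ : Heis) : genZ * γ = γ * genZ := by
  obtain ⟨_, a, b, c, rfl⟩ := γ
  apply Subtype.ext
  change uni 0 1 0 * uni a b c = uni a b c * uni 0 1 0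
  rw [uni_mul, uni_mul]
  congr 1 <;> ring

theorem el_mul_comm_of_central {ζ : Heis} (hζ : ∀ γ, ζ * γ = γ * ζ) (h : MonoidAlgebra ℤ Heis) :
    el ζ * h = h * el ζ := by
  induction h using MonoidAlgebra.induction_linear with
  | zero => simp
  | add g h hg hh => rw [mul_add, add_mul, hg, hh]
  | single γ c => simp [el, hζ]

theorem el_genZ_inv_mul_comm (h : MonoidAlgebra ℤ Heis) : el genZ⁻¹ * h = h * el genZ⁻¹ :=
  el_mul_comm_of_central (fun γ => ((show Commute genZ γ from genZ_mul_comm γ).inv_left).eq) h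

theorem el_genY_mul_el_genX : el genY * el genX = el genZ⁻¹ * (el genX * el genY) := by
  rw [el_mul, el_mul, el_mul]
  congr 1
  rw [eq_inv_mul_iff_mul_eq]
  apply Subtype.ext
  simp [genX, genY, genZ, uni_mul]

/-- `(x + y) ^ n` is supported on the elements of degree `n`. -/
theorem degree_eq_of_coeff_add_pow_ne_zero (n : ℕ) (γ : Heis)
    (h : ((el genX + el genY) ^ n).coeff γ ≠ 0) : degree γ = n := by
  classical
  induction n generalizing γ with
  | zero =>
    rw [pow_zero, MonoidAlgebra.one_def, MonoidAlgebra.coeff_single, Finsupp.single_apply] at h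
    have : (1 : Heis) = γ := by
      by_contra hne
      simp [hne] at h
    simp [← this]
  | succ n ih =>
    have hsplit : γ = genX * (genX⁻¹ * γ) ∧ γ = genY * (genY⁻¹ * γ) := by simp
    have key : ((el genX + el genY) ^ (n + 1)).coeff γ =
        ((el genX + el genY) ^ n).coeff (genX⁻¹ * γ) +
        ((el genX + el genY) ^ n).coeff (genY⁻¹ * γ) := by
      rw [pow_succ', add_mul]
      simp [el, MonoidAlgebra.coeff_single_mul_apply]
    rw [key] at h
    rcases (show ((el genX + el genY) ^ n).coeff (genX⁻¹ * γ) ≠ 0 ∨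
        ((el genX + el genY) ^ n).coeff (genY⁻¹ * γ) ≠ 0 by
      by_contra! hc; exact h (by rw [hc.1, hc.2, add_zero])) with h' | h'
    · rw [hsplit.1, degree_mul, ih _ h', degree_genX]; push_cast; ring
    · rw [hsplit.2, degree_mul, ih _ h', degree_genY]; push_cast; ring

theorem coeff_add_pow_eq_zero {n : ℕ} {γ : Heis} (h : n ≠ (degree γ).toNat) :
    ((el genX + el genY) ^ n).coeff γ = 0 := by
  by_contra hne
  have := degree_eq_of_coeff_add_pow_ne_zero n γ hne
  omega

/-- Only the term `n = degree γ` of the series contributes to the coordinate at `γ`. -/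
theorem fStarSharp_eq (γ : Heis) : fStarSharp γ = (1 / 2 ^ ((degree γ).toNat + 1) : ℝ) *
    (((el genX + el genY) ^ (degree γ).toNat).coeff γ : ℝ) :=
  tsum_eq_single _ fun n hn => by rw [coeff_add_pow_eq_zero hn]; simp

theorem hasSum_fStarSharp (γ : Heis) : HasSum (fun n : ℕ => (1 / 2 ^ (n + 1) : ℝ) *
    (((el genX + el genY) ^ n).coeff γ : ℝ)) (fStarSharp γ) := by
  rw [fStarSharp_eq]
  exact hasSum_single _ fun n hn => by rw [coeff_add_pow_eq_zero hn]; simp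

theorem l1Norm_el (γ : Heis) : l1Norm (el γ) = 1 := by simp [el]

theorem l1Norm_add_pow_le (n : ℕ) : l1Norm ((el genX + el genY) ^ n) ≤ 2 ^ n :=
  l1Norm_pow_le _ ((l1Norm_add_le _ _).trans (by rw [l1Norm_el, l1Norm_el]; norm_num)) n

theorem memℓp_infty_fStarSharp : Memℓp fStarSharp ∞ := by
  refine memℓp_infty ⟨1, ?_⟩
  rintro _ ⟨γ, rfl⟩
  set n := (degree γ).toNat with hn
  have h := (abs_coeff_le_l1Norm _ γ).trans (l1Norm_add_pow_le n)
  change ‖fStarSharp γ‖ ≤ 1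
  rw [fStarSharp_eq, ← hn, Real.norm_eq_abs, abs_mul, abs_of_nonneg (by positivity), one_div,
    inv_mul_le_iff₀ (by positivity), mul_one, pow_succ]
  have : (0 : ℝ) < 2 ^ n := by positivity
  linarith

theorem hasSum_lmul_fStarSharp (g : MonoidAlgebra ℤ Heis) (γ : Heis) :
    HasSum (fun n : ℕ => (1 / 2 ^ (n + 1) : ℝ) * ((g * (el genX + el genY) ^ n).coeff γ : ℝ))
      (lmul g fStarSharp γ) := by
  rw [lmul_apply_eq_sum]
  refine (hasSum_sum fun δ (_ : δ ∈ g.coeff.support) =>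
    (hasSum_fStarSharp (δ⁻¹ * γ)).mul_left (g.coeff δ : ℝ)).congr_fun fun n => ?_
  rw [MonoidAlgebra.coeff_mul_apply_left, Finsupp.sum]
  push_cast
  rw [Finset.mul_sum]
  exact Finset.sum_congr rfl fun δ _ => by ring

theorem hasSum_rmul_fStarSharp (g : MonoidAlgebra ℤ Heis) (γ : Heis) :
    HasSum (fun n : ℕ => (1 / 2 ^ (n + 1) : ℝ) * (((el genX + el genY) ^ n * g).coeff γ : ℝ))
      (rmul fStarSharp g γ) := by
  rw [rmul_apply_eq_sum]
  refine (hasSum_sum fun δ (_ : δ ∈ g.coeff.support) =>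
    (hasSum_fStarSharp (γ * δ⁻¹)).mul_right (g.coeff δ : ℝ)).congr_fun fun n => ?_
  rw [MonoidAlgebra.coeff_mul_apply_right, Finsupp.sum]
  push_cast
  rw [Finset.mul_sum]
  exact Finset.sum_congr rfl fun δ _ => by ring

theorem lmul_fStarSharp_eq_rmul {g : MonoidAlgebra ℤ Heis}
    (hg : g * (el genX + el genY) = (el genX + el genY) * g) :
    lmul g fStarSharp = rmul fStarSharp g := by
  funext γ
  refine (hasSum_lmul_fStarSharp g γ).unique ?_
  have h := hasSum_rmul_fStarSharp g γ
  simp only [← (show Commute g (el genX + el genY) from hg).pow_right _ |>.eq] at h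
  exact h

/-! ### The formal inverse -/

/-- `(2 - S) ∑ 2 ^ (-n - 1) S ^ n` telescopes to `1`. -/
theorem lmul_two_sub_fStarSharp : lmul (2 - el genX - el genY) fStarSharp = coords 1 := by
  funext γ
  have h1 := (hasSum_fStarSharp γ).mul_left 2
  have h2 := (hasSum_nat_add_iff' 1).2 h1
  have h3 := h1.sub h2
  have h4 : 2 * fStarSharp γ - (2 * fStarSharp γ - ∑ i ∈ Finset.range 1,
      2 * ((1 / 2 ^ (i + 1) : ℝ) * (((el genX + el genY) ^ i).coeff γ : ℝ))) = coords 1 γ := by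
    simp [coords]
  rw [h4] at h3
  refine (hasSum_lmul_fStarSharp _ γ).unique (h3.congr_fun fun n => ?_)
  have e : (2 - el genX - el genY) * (el genX + el genY) ^ n =
      (2 : ℤ) • (el genX + el genY) ^ n - (el genX + el genY) ^ (n + 1) := by
    rw [pow_succ', sub_sub, sub_mul, zsmul_eq_mul, Int.cast_ofNat]
  rw [e]
  simp only [MonoidAlgebra.coeff_sub, MonoidAlgebra.coeff_smul, Finsupp.sub_apply,
    Finsupp.smul_apply, smul_eq_mul]
  push_cast
  rw [pow_succ (2 : ℝ) (n + 1)]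
  field_simp

/-- The coefficients of `f^* = 2 - x - y` add up to `0`. -/
theorem sum_coeff_two_sub : ((2 - el genX - el genY).coeff.sum fun _ c => c) = 0 := by
  have hsum : ∀ a b : MonoidAlgebra ℤ Heis, ((a - b).coeff.sum fun _ c => c) =
      (a.coeff.sum fun _ c => c) - b.coeff.sum fun _ c => c := fun a b =>
    Finsupp.sum_sub_index fun _ _ _ => rfl
  have h2 : (2 : MonoidAlgebra ℤ Heis) = MonoidAlgebra.single 1 2 := by
    rw [← Int.cast_ofNat, MonoidAlgebra.intCast_def]; rfl
  rw [hsum, hsum, h2]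
  simp [el]

theorem isFormalInverse_fStarSharp : IsFormalInverse (2 - el genX - el genY) fStarSharp := by
  have hcomm : (2 - el genX - el genY) * (el genX + el genY) =
      (el genX + el genY) * (2 - el genX - el genY) := by noncomm_ring
  have hl := lmul_two_sub_fStarSharp
  have hr := hl
  rw [lmul_fStarSharp_eq_rmul hcomm] at hr
  have hni := not_invertibleL1_of_sum_eq_zero sum_coeff_two_sub
  exact ⟨hni, fun hm => hni ⟨_, hm, hl, hr⟩, hl, hr⟩

/-! ### Decay of `(1 - q) ^ 2 (x + y) ^ n` in `ℓ¹` -/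

/-- The normalized norm `‖(1 - z⁻ᵃ) (x + y) ^ n‖₁ / 2 ^ n`: twice the total variation distance
between a uniformly random word of length `n` in `x` and `y`, evaluated in `ℍ`, and its translate by
`z⁻ᵃ`. -/
noncomputable def shiftNorm (n a : ℕ) : ℝ :=
  l1Norm ((1 - el genZ⁻¹ ^ a) * (el genX + el genY) ^ n) / 2 ^ n

theorem shiftNorm_nonneg (n a : ℕ) : 0 ≤ shiftNorm n a :=
  div_nonneg (l1Norm_nonneg _) (by positivity)

theorem shiftNorm_le_two (n a : ℕ) : shiftNorm n a ≤ 2 := by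
  rw [shiftNorm, div_le_iff₀ (by positivity)]
  refine (l1Norm_mul_le _ _).trans (mul_le_mul ?_ (l1Norm_add_pow_le n) (l1Norm_nonneg _) (by simp))
  refine (l1Norm_sub_le _ _).trans ?_
  rw [el_pow, l1Norm_el, l1Norm_one]
  norm_num

theorem l1Norm_el_mul_add_pow_mul_el_mul_le (γ δ : Heis) (m : ℕ) (h : MonoidAlgebra ℤ Heis) :
    l1Norm (el γ * (el genX + el genY) ^ m * el δ * h) ≤ 2 ^ m * l1Norm h := by
  refine (l1Norm_mul_le _ _).trans (mul_le_mul_of_nonneg_right ?_ (l1Norm_nonneg _))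
  have h1 := l1Norm_mul_le (el γ) ((el genX + el genY) ^ m)
  have h2 := l1Norm_mul_le (el γ * (el genX + el genY) ^ m) (el δ)
  rw [l1Norm_el] at h1 h2
  linarith [l1Norm_add_pow_le m]

/-- Of the words `x w x`, `y w y`, `x w y`, `y w x` with `|w| = a - 1`, the last two can be paired:
their sum is a multiple of `1 + q ^ a`, which turns the factor `1 - q ^ a` into `1 - q ^ (2 a)`. -/
theorem shiftNorm_add_le (n a : ℕ) (ha : 1 ≤ a) :
    shiftNorm (n + (a + 1)) a ≤ shiftNorm n a / 2 + shiftNorm n (2 * a) / 4 := by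
  obtain ⟨m, rfl⟩ : ∃ m, a = m + 1 := ⟨a - 1, by omega⟩
  have key := one_sub_mul_add_pow_of_qCommute el_genZ_inv_mul_comm el_genY_mul_el_genX m n
  have h1 := l1Norm_el_mul_add_pow_mul_el_mul_le genX genX m
    ((1 - el genZ⁻¹ ^ (m + 1)) * (el genX + el genY) ^ n)
  have h2 := l1Norm_el_mul_add_pow_mul_el_mul_le genY genY m
    ((1 - el genZ⁻¹ ^ (m + 1)) * (el genX + el genY) ^ n)
  have h3 := l1Norm_el_mul_add_pow_mul_el_mul_le genX genY m
    ((1 - el genZ⁻¹ ^ (2 * (m + 1))) * (el genX + el genY) ^ n)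
  have h4 := (l1Norm_add_le _ _).trans
    (add_le_add ((l1Norm_add_le _ _).trans (add_le_add h1 h2)) h3)
  rw [← key] at h4
  unfold shiftNorm
  rw [div_le_iff₀ (by positivity)]
  refine h4.trans (le_of_eq ?_)
  rw [pow_add (2 : ℝ) n (m + 1 + 1), pow_succ (2 : ℝ) (m + 1), pow_succ (2 : ℝ) m]
  field_simp
  ring

theorem shiftNorm_one_le (n : ℕ) (hn : 1 ≤ n) :
    shiftNorm n 1 ≤ 64 * (1 / (n : ℝ)) ^ (3 / 4 : ℝ) := by
  simpa using le_of_halving_recursion shiftNorm_le_two shiftNorm_add_le n 1 le_rfl hn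

/-- Each factor `1 - q` is absorbed by one half of the word. -/
theorem l1Norm_sq_mul_add_pow_le (k m : ℕ) :
    l1Norm ((1 - el genZ⁻¹) ^ 2 * (el genX + el genY) ^ (k + m)) / 2 ^ (k + m) ≤
      shiftNorm k 1 * shiftNorm m 1 := by
  have e : (1 - el genZ⁻¹) ^ 2 * (el genX + el genY) ^ (k + m) =
      ((1 - el genZ⁻¹ ^ 1) * (el genX + el genY) ^ k) *
        ((1 - el genZ⁻¹ ^ 1) * (el genX + el genY) ^ m) := by
    have hc : (1 - el genZ⁻¹) * (el genX + el genY) ^ k =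
        (el genX + el genY) ^ k * (1 - el genZ⁻¹) := by
      rw [sub_mul, mul_sub, one_mul, mul_one, el_genZ_inv_mul_comm]
    rw [pow_one, pow_two, pow_add, mul_assoc, ← mul_assoc _ ((el genX + el genY) ^ k), hc]
    simp only [mul_assoc]
    rw [← mul_assoc, hc, mul_assoc]
  rw [shiftNorm, shiftNorm, div_mul_div_comm, ← pow_add, e]
  gcongr
  exact l1Norm_mul_le _ _

theorem summable_l1Norm_sq_mul_add_pow : Summable fun n : ℕ =>
    l1Norm ((1 - el genZ⁻¹) ^ 2 * (el genX + el genY) ^ n) / 2 ^ n := by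
  have hs : Summable fun n : ℕ => 64 ^ 2 * (4 : ℝ) ^ (3 / 2 : ℝ) * (1 / (n : ℝ) ^ (3 / 2 : ℝ)) :=
    (Real.summable_one_div_nat_rpow.2 (by norm_num)).mul_left _
  rw [← summable_nat_add_iff 2] at hs ⊢
  refine Summable.of_nonneg_of_le (fun n => div_nonneg (l1Norm_nonneg _) (by positivity))
    (fun n => ?_) hs
  obtain ⟨k, m, hkm, hk, hm⟩ : ∃ k m, n + 2 = k + m ∧ n + 2 ≤ 4 * k ∧ n + 2 ≤ 4 * m :=
    ⟨(n + 2) / 2, (n + 2) - (n + 2) / 2, by omega, by omega, by omega⟩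
  have bound : ∀ j : ℕ, n + 2 ≤ 4 * j →
      shiftNorm j 1 ≤ 64 * (4 / ((n + 2 : ℕ) : ℝ)) ^ (3 / 4 : ℝ) := by
    intro j hj
    have hj0 : (0 : ℝ) < j := by exact_mod_cast (by omega : 0 < j)
    refine (shiftNorm_one_le j (by omega)).trans ?_
    refine mul_le_mul_of_nonneg_left (Real.rpow_le_rpow (by positivity) ?_ (by norm_num))
      (by norm_num)
    rw [div_le_div_iff₀ hj0 (by positivity), one_mul]
    exact_mod_cast hj
  rw [hkm]
  refine (l1Norm_sq_mul_add_pow_le k m).trans ?_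
  rw [← hkm]
  refine (mul_le_mul (bound k hk) (bound m hm) (shiftNorm_nonneg _ _) (by positivity)).trans_eq ?_
  have hN : (0 : ℝ) < 4 / ((n + 2 : ℕ) : ℝ) := by positivity
  calc 64 * (4 / ((n + 2 : ℕ) : ℝ)) ^ (3 / 4 : ℝ) * (64 * (4 / ((n + 2 : ℕ) : ℝ)) ^ (3 / 4 : ℝ))
      = 64 ^ 2 *
        ((4 / ((n + 2 : ℕ) : ℝ)) ^ (3 / 4 : ℝ) * (4 / ((n + 2 : ℕ) : ℝ)) ^ (3 / 4 : ℝ)) := by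
        ring
    _ = 64 ^ 2 * (4 / ((n + 2 : ℕ) : ℝ)) ^ (3 / 2 : ℝ) := by
        rw [← Real.rpow_add hN]; norm_num
    _ = _ := by rw [Real.div_rpow (by norm_num) (by positivity)]; ring

/-! ### The central multiplier -/

theorem summable_abs_lmul_fStarSharp {g : MonoidAlgebra ℤ Heis}
    (hg : Summable fun n : ℕ => l1Norm (g * (el genX + el genY) ^ n) / 2 ^ n) :
    Summable fun γ => |lmul g fStarSharp γ| := by
  set t : Heis → ℕ → ℝ := fun γ n =>
    (1 / 2 ^ (n + 1) : ℝ) * ((g * (el genX + el genY) ^ n).coeff γ : ℝ) with ht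
  have habs : ∀ γ n, |t γ n| = 1 / 2 ^ (n + 1) * |((g * (el genX + el genY) ^ n).coeff γ : ℝ)| :=
    fun γ n => by rw [ht, abs_mul, abs_of_nonneg (by positivity)]
  have hpart : ∀ (s : Finset Heis) (n : ℕ),
      ∑ γ ∈ s, |t γ n| ≤ l1Norm (g * (el genX + el genY) ^ n) / 2 ^ n := by
    intro s n
    simp only [habs]
    rw [← Finset.mul_sum, one_div, ← div_eq_inv_mul]
    refine div_le_div₀ (l1Norm_nonneg _) (sum_abs_coeff_le_l1Norm _ _) (by positivity) ?_
    exact pow_le_pow_right₀ (by norm_num) (Nat.le_succ n)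
  have hsum : ∀ γ, Summable fun n => |t γ n| := fun γ =>
    Summable.of_nonneg_of_le (fun _ => abs_nonneg _) (fun n => by simpa using hpart {γ} n) hg
  refine summable_of_sum_le (c := ∑' n : ℕ, l1Norm (g * (el genX + el genY) ^ n) / 2 ^ n)
    (fun _ => abs_nonneg _) fun s => ?_
  calc ∑ γ ∈ s, |lmul g fStarSharp γ| ≤ ∑ γ ∈ s, ∑' n, |t γ n| := by
        refine Finset.sum_le_sum fun γ _ => ?_
        rw [← (hasSum_lmul_fStarSharp g γ).tsum_eq]
        exact norm_tsum_le_tsum_norm (f := t γ) (hsum γ)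
    _ = ∑' n, ∑ γ ∈ s, |t γ n| := (Summable.tsum_finsetSum fun γ _ => hsum γ).symm
    _ ≤ _ := (summable_sum fun γ _ => hsum γ).tsum_le_tsum (hpart s) hg

theorem one_sub_el_genZ_inv_sq_mul_comm (h : MonoidAlgebra ℤ Heis) :
    (1 - el genZ⁻¹) ^ 2 * h = h * (1 - el genZ⁻¹) ^ 2 :=
  ((Commute.one_left h).sub_left (el_genZ_inv_mul_comm h)).pow_left 2

theorem isCentralMultiplier_fStarSharp : IsCentralMultiplier ((1 - el genZ⁻¹) ^ 2) fStarSharp where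
  central := one_sub_el_genZ_inv_sq_mul_comm
  comm := lmul_fStarSharp_eq_rmul (one_sub_el_genZ_inv_sq_mul_comm _)
  mem := memℓp_one_iff_summable.2 (summable_abs_lmul_fStarSharp summable_l1Norm_sq_mul_add_pow)

theorem one_sub_sq_expand (γ : Heis) : (1 - el γ) ^ 2 =
    MonoidAlgebra.single 1 1 + MonoidAlgebra.single γ (-2) + MonoidAlgebra.single (γ ^ 2) 1 := by
  have h : MonoidAlgebra.single γ (-2 : ℤ) = -(2 * el γ) := by
    rw [show -(2 * el γ) = (-2 : ℤ) • el γ by rw [neg_smul, zsmul_eq_mul, Int.cast_ofNat]]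
    simp [el]
  have h' : MonoidAlgebra.single (γ ^ 2) (1 : ℤ) = el γ ^ 2 := by simp [el]
  rw [h, h', ← MonoidAlgebra.one_def]
  noncomm_ring

theorem involution_one_sub_el_sq (γ : Heis) :
    involution ((1 - el γ) ^ 2) = (1 - el γ⁻¹) ^ 2 := by
  rw [one_sub_sq_expand, one_sub_sq_expand, involution_add, involution_add, involution_single,
    involution_single, involution_single, inv_one, inv_pow]

theorem involution_two_sub : involution (2 - el genX - el genY) = fHeis := by
  rw [← involution_fHeis, involution_involution]

/-! ### The homoclinic point -/

section PrincipalAction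

variable {Γ : Type*} [Group Γ]

/-- If `f` has coefficient sum `0`, then the constant points of `𝕋^Γ` lie in `X_f` and are fixed by
`α_f`; small constants contradict expansiveness. -/
theorem not_isExpansive_of_sum_eq_zero {f : MonoidAlgebra ℤ Γ}
    (hf : (f.coeff.sum fun _ c => c) = 0) : ¬ (principalAction f).IsExpansive := by
  rintro ⟨U, hU, hUeq⟩
  have hmem : ∀ t : UnitAddCircle, (fun _ : Γ => t) ∈ principalGroup f := by
    intro t
    change rho f (fun _ : Γ => t) = 0
    funext γ
    rw [rho_apply, Finsupp.sum, ← Finset.sum_smul]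
    change (f.coeff.sum fun _ c => c) • t = 0
    rw [hf, zero_smul]
  let const : UnitAddCircle → principalGroup f := fun t => ⟨fun _ => t, hmem t⟩
  have hcont : Continuous const := (continuous_pi fun _ => continuous_id).subtype_mk _
  -- in terms of `ℝ`, where a small positive number can be picked
  have hreal : {r : ℝ | const (r : UnitAddCircle) ∈ U} ∈ 𝓝 (0 : ℝ) :=
    (hcont.comp (AddCircle.continuous_mk' (1 : ℝ))).continuousAt.preimage_mem_nhds hU
  obtain ⟨ε, hε, hball⟩ := Metric.mem_nhds_iff.1 hreal
  set r : ℝ := min (ε / 2) (1 / 2) with hr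
  have hr0 : 0 < r := by positivity
  have hr1 : r ≤ 1 / 2 := min_le_right _ _
  have hrU : const (r : UnitAddCircle) ∈ U := hball (by
    rw [Metric.mem_ball, Real.dist_eq, sub_zero, abs_of_pos hr0]
    exact (min_le_left _ _).trans_lt (by linarith))
  have hmemInter : const (r : UnitAddCircle) ∈ ⋂ γ : Γ, ((principalAction f).act γ) '' U :=
    Set.mem_iInter.2 fun γ => ⟨const r, hrU, rfl⟩
  rw [hUeq] at hmemInter
  have h0 : (r : UnitAddCircle) = 0 := congrFun (congrArg Subtype.val hmemInter) 1
  obtain ⟨n, hn⟩ := (AddCircle.coe_eq_zero_iff (1 : ℝ)).1 h0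
  rw [zsmul_eq_mul, mul_one] at hn
  rw [← hn] at hr0 hr1
  have h1 : 0 < n := by exact_mod_cast hr0
  have h2 : (1 : ℝ) ≤ n := by exact_mod_cast h1
  linarith

theorem norm_coe_unitAddCircle_le (r : ℝ) : ‖(r : UnitAddCircle)‖ ≤ |r| := by
  rw [UnitAddCircle.norm_eq]
  simpa using round_le r 0

/-- Summable points of `X_f` are homoclinic: their coordinates tend to `0` at infinity. -/
theorem isSummableHomoclinic_of_summable {f : MonoidAlgebra ℤ Γ} {v : principalGroup f}
    (hv : Summable fun γ : Γ => ‖v.1 γ‖) : IsSummableHomoclinic f v := by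
  refine ⟨?_, hv⟩
  refine tendsto_subtype_rng.2 (tendsto_pi_nhds.2 fun γ' => ?_)
  have h0 : Filter.Tendsto v.1 Filter.cofinite (𝓝 0) :=
    tendsto_zero_iff_norm_tendsto_zero.2 hv.tendsto_cofinite_zero
  have hinj : Function.Injective fun γ : Γ => γ⁻¹ * γ' := fun a b hab => by simpa using hab
  exact h0.comp hinj.tendsto_cofinite

/-- If `u · f^*` has integer coordinates, then `u mod 1` lies in `X_f`. -/
theorem coe_mem_principalGroup {f k : MonoidAlgebra ℤ Γ} {u : Γ → ℝ}
    (hu : rmul u (involution f) = coords k) :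
    (fun γ => (u γ : UnitAddCircle)) ∈ principalGroup f := by
  change rho f (fun γ => (u γ : UnitAddCircle)) = 0
  funext γ'
  have h := congrFun hu γ'
  rw [rmul, sum_coeff_involution] at h
  have h2 : ((k.coeff γ' : ℝ) : UnitAddCircle) = 0 := by
    rw [AddCircle.coe_eq_zero_iff]
    exact ⟨k.coeff γ', by simp⟩
  rw [Pi.zero_apply, ← h2]
  change _ = ((coords k γ' : ℝ) : UnitAddCircle)
  rw [← h, rho_apply, Finsupp.sum, Finsupp.sum]
  change _ = (QuotientAddGroup.mk' (AddSubgroup.zmultiples (1 : ℝ))) _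
  rw [map_sum]
  refine Finset.sum_congr rfl fun δ _ => ?_
  rw [inv_inv, mul_comm, ← zsmul_eq_mul, map_zsmul]
  rfl

end PrincipalAction

theorem degree_genZ : degree genZ = 0 := by simp [degree, genZ, uni]

theorem genZ_ne_one : genZ ≠ 1 := fun h => by
  have := congrArg (fun γ : Heis => γ.1.1 0 2) h
  simp [genZ, uni] at this

theorem genZ_sq_ne_one : genZ ^ 2 ≠ 1 := fun h => by
  have h2 : (genZ ^ 2 : Heis).1 = uni 0 2 0 := by
    rw [pow_two]
    change uni 0 1 0 * uni 0 1 0 = _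
    rw [uni_mul]
    norm_num
  have := congrArg (fun γ : Heis => γ.1.1 0 2) h
  simp only [h2] at this
  simp [uni] at this

theorem coeff_one_sub_sq_mul_add_pow (n : ℕ) :
    ((1 - el genZ⁻¹) ^ 2 * (el genX + el genY) ^ n).coeff 1 =
      ((el genX + el genY) ^ n).coeff 1 - 2 * ((el genX + el genY) ^ n).coeff genZ +
        ((el genX + el genY) ^ n).coeff (genZ ^ 2) := by
  rw [one_sub_sq_expand, add_mul, add_mul]
  simp only [MonoidAlgebra.coeff_add, Finsupp.add_apply, MonoidAlgebra.coeff_single_mul_apply]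
  simp
  ring

/-- Only the constant term of the series reaches the identity, with weight `1 / 2`. -/
theorem lmul_fStarSharp_one : lmul ((1 - el genZ⁻¹) ^ 2) fStarSharp 1 = 1 / 2 := by
  classical
  refine (hasSum_lmul_fStarSharp _ 1).unique ?_
  have h := hasSum_single (f := fun n : ℕ => (1 / 2 ^ (n + 1) : ℝ) *
    (((1 - el genZ⁻¹) ^ 2 * (el genX + el genY) ^ n).coeff 1 : ℝ)) 0 fun n hn => by
      have hz2 : degree (genZ ^ 2) = 0 := by rw [pow_two, degree_mul, degree_genZ, add_zero]
      rw [coeff_one_sub_sq_mul_add_pow, coeff_add_pow_eq_zero (by simpa using hn),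
        coeff_add_pow_eq_zero (by simpa [degree_genZ] using hn),
        coeff_add_pow_eq_zero (by simpa [hz2] using hn)]
      simp
  have h0 : ((1 - el genZ⁻¹) ^ 2 * (el genX + el genY) ^ 0).coeff 1 = 1 := by
    rw [coeff_one_sub_sq_mul_add_pow, pow_zero, MonoidAlgebra.one_def]
    simp [genZ_ne_one.symm, genZ_sq_ne_one.symm]
  rw [h0] at h
  simpa using h

end AlgAction

open AlgAction
theorem theorem4p2 :
    -- the two expressions for the formal inverse of `f^* = 2 - x - y`, and its basic properties
    (∀ n : ℕ, (el genX + el genY) ^ n =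
      ∑ k ∈ Finset.range (n + 1), el (genX ^ k * genY ^ (n - k)) *
        Polynomial.aeval (el genZ⁻¹) (qBinomial n k)) ∧
    (∀ γ : Heis, HasSum
      (fun n : ℕ => (1 / 2 ^ (n + 1) : ℝ) *
        (((el genX + el genY) ^ n).coeff γ : ℝ)) (fStarSharp γ)) ∧
    Memℓp fStarSharp ∞ ∧
    IsFormalInverse (2 - el genX - el genY) fStarSharp ∧
    -- `(1 - z⁻¹)^2` is a central multiplier of it
    IsCentralMultiplier ((1 - el genZ⁻¹) ^ 2) fStarSharp ∧
    IsFormalInverse fHeis fSharp ∧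
    IsCentralMultiplier ((1 - el genZ) ^ 2) fSharp ∧
    -- `α_f` is nonexpansive and has the nonzero summable homoclinic point `x^{((1-z)^2)}`
    ¬ (principalAction fHeis).IsExpansive ∧
    ∃ p : principalGroup fHeis,
      (p : Heis → UnitAddCircle) = reducedPoint fSharp ((1 - el genZ) ^ 2) ∧
      (∀ γ : Heis, (p : Heis → UnitAddCircle) γ =
        ((lmul ((1 - el genZ⁻¹) ^ 2) fStarSharp γ : ℝ) : UnitAddCircle)) ∧
      p ≠ 0 ∧ IsSummableHomoclinic fHeis p := by
  have hX : involution ((1 - el genZ) ^ 2) = (1 - el genZ⁻¹) ^ 2 := involution_one_sub_el_sq _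
  have hX' : involution ((1 - el genZ⁻¹) ^ 2) = (1 - el genZ) ^ 2 := by
    rw [← hX, involution_involution]
  have hfi := isFormalInverse_fStarSharp
  have hcm := isCentralMultiplier_fStarSharp
  have hred : reducedPoint fSharp ((1 - el genZ) ^ 2) = fun γ =>
      ((lmul ((1 - el genZ⁻¹) ^ 2) fStarSharp γ : ℝ) : UnitAddCircle) := by
    rw [hcm.comm]
    funext γ
    rw [reducedPoint, hX, fSharp, starFun_starFun]
  have hmem : (fun γ => ((lmul ((1 - el genZ⁻¹) ^ 2) fStarSharp γ : ℝ) : UnitAddCircle)) ∈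
      principalGroup fHeis := by
    refine coe_mem_principalGroup (k := (1 - el genZ⁻¹) ^ 2) ?_
    rw [involution_fHeis, rmul_lmul, hfi.right, lmul_coords, mul_one]
  refine ⟨fun n => ?_, hasSum_fStarSharp, memℓp_infty_fStarSharp, hfi, hcm, ?_, ?_, ?_,
    ⟨_, hmem⟩, hred.symm, fun γ => rfl, fun h0 => ?_, ?_⟩
  · rw [add_pow_of_qCommute el_genZ_inv_mul_comm el_genY_mul_el_genX]
    simp only [el_pow, el_mul]
  · rw [← involution_two_sub]
    exact hfi.involution
  · rw [← hX']
    exact hcm.involution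
  · refine not_isExpansive_of_sum_eq_zero ?_
    rw [← involution_two_sub, sum_coeff_involution]
    exact sum_coeff_two_sub
  · have h1 : ((lmul ((1 - el genZ⁻¹) ^ 2) fStarSharp 1 : ℝ) : UnitAddCircle) = 0 :=
      congrFun (congrArg Subtype.val h0) 1
    rw [lmul_fStarSharp_one, AddCircle.coe_eq_zero_iff] at h1
    obtain ⟨n, hn⟩ := h1
    rw [zsmul_eq_mul, mul_one, eq_div_iff two_ne_zero] at hn
    have : n * 2 = 1 := by exact_mod_cast hn
    omega
  · exact isSummableHomoclinic_of_summable <| Summable.of_nonneg_of_le (fun _ => norm_nonneg _)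
      (fun γ => norm_coe_unitAddCircle_le _) (memℓp_one_iff_summable.1 hcm.mem)
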